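/- Let $W$ be a discrete memoryless channel with finite input alphabet $\mathcal X$, finite output alphabet $\mathcal Y$ and capacity $C=\max_{P_X} I(X;Y)>0$, and let $K\ge 1$ be fixed. All logarithms are to base $2$. *Codes and errors.* A $K$-MOID code of length $n$ for $N$ receivers consists of an encoder $\varphi:\mathcal Z\times\mathcal V\to\mathcal X^n$, where $\mathcal Z$ is the set of all $K$-element subsets of $\mathcal N=\{1,\dots,N\}$, and decoders $\psi_i:\mathcal Y^n\to\{\mathrm T,\mathrm F\}$, $i\in\mathcal N$. Its rate is $R^{(n)}=\frac1n\log\log N$. With $V$ uniform on $\mathcal V$ and $\varphi(\mathcal K,V)$ sent over $W$, $\lambda_1^{(n)}$ is the maximum over $\mathcal K\in\mathcal Z$ and $i\in\mathcal K$ of the probability that $\psi_i$ outputs $\mathrm F$, and $\lambda_2^{(n)}$ is the maximum over $\mathcal K\in\mathcal Z$ and $i\notin\mathcal K$ of the probability that $\psi_i$ outputs $\mathrm T$. *Coding Scheme 1.* Let $q=2^m$, $m\ge1$, $k\ge1$, $t=k-1$, and let $\{h_v\}_{v\in\mathcal V}$ be an $\varepsilon$-almost strongly universal class of hash functions $h_v:\mathcal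 N\to\mathcal B$ with $N=q^{kq^{t}}$, $\mathcal B=\mathrm{GF}(q)$, $|\mathcal V|=q^{k+2}$ and $\varepsilon=\frac kq+\frac{q^t-1}{q^k}$; that is, $|\{v:h_v(\alpha)=\beta\}|=|\mathcal V|/|\mathcal B|$ for all $\alpha,\beta$, and $|\{v:h_v(\alpha_1)=\beta_1,\,h_v(\alpha_2)=\beta_2\}|\le\varepsilon|\mathcal V|/|\mathcal B|$ for all $\alpha_1\ne\alpha_2$ and all $\beta_1,\beta_2$. Let $f:\mathcal V\times\mathcal B^K\to\mathcal X^n$ and $g:\mathcal Y^n\to\mathcal V\times\mathcal B^K$ be the encoder and decoder of a transmission code. The $K$-MOID code is given by $\varphi(\{i_1<\dots<i_K\},v)=f(v,h_v(i_1),\dots,h_v(i_K))$, and by $\psi_i(y^n)=\mathrm T$ if and only if $h_{\hat v}(i)=\beta_j$ for some $1\le j\le K$, where $(\hat v,\beta_1,\dots,\beta_K)=g(y^n)$. Then the $K$-MOID codes constructed by Coding Scheme 1 can achieve $$\lim_{n\to\infty}R^{(n)}=C,\qquad \lim_{n\to\infty}\lambda_1^{(n)}=0,\qquad \lim_{n\to\infty}\lambda_2^{(n)}=0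 .$$ More precisely, there are parameters $k_n,m_n\ge 1$ and transmission codes $(f_n,g_n)$ of length $n$, for all $n$, such that hash classes with the parameters $(k_n,m_n)$ exist and the three limits hold whichever such classes are used. -/

import Mathlib

open Filter Topology

noncomputable section

/-- A discrete memoryless channel with finite output alphabet `Y`: `prob x y` is the transition
probability `W(y | x)`. -/
structure DMC (X Y : Type*) [Fintype Y] where
  prob : X → Y → ℝ
  prob_nonneg : ∀ x y, 0 ≤ prob x y
  sum_prob : ∀ x, ∑ y, prob x y = 1

namespace DMC

variable {X Y : Type*} [Fintype Y]

/-- The `n`-fold memoryless extension `Wⁿ(yⁿ | xⁿ) = ∏ₜ W(yₜ | xₜ)`. -/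
def blockProb (W : DMC X Y) {n : ℕ} (x : Fin n → X) (y : Fin n → Y) : ℝ :=
  ∏ t, W.prob (x t) (y t)

/-- The mutual information `I(X; Y)` in bits, for input distribution `P`. Summands with
`P x * W(y | x) = 0` vanish; in all the others the quotient is positive. -/
def mutualInfo [Fintype X] (W : DMC X Y) (P : X → ℝ) : ℝ :=
  ∑ x, ∑ y, P x * W.prob x y *
    Real.logb 2 (W.prob x y / ∑ x', P x' * W.prob x' y)

/-- The capacity `C = max_P I(X; Y)`, over all probability distributions `P` on `X`. -/
def capacity [Fintype X] (W : DMC X Y) : ℝ :=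
  sSup (W.mutualInfo '' stdSimplex ℝ X)

end DMC

/-- The possible sets of `K` selected receivers among `N`. -/
abbrev Selection (N K : ℕ) : Type :=
  {S : Finset (Fin N) // S.card = K}

/-- A `K`-MOID code for `N` receivers with code length `n`, whose encoder uses a random number
in `V`. The decoder output `true` stands for `T`, `false` for `F`. -/
structure MOIDCode (X Y V : Type*) (N K n : ℕ) where
  enc : Selection N K → V → (Fin n → X)
  dec : Fin N → (Fin n → Y) → Bool

namespace MOIDCode

variable {X Y V : Type*} [Fintype Y] [Fintype V] {N K n : ℕ}

/-- The probability that receiver `i` outputs `u` when `S` is encoded, the random number is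
uniform on `V`, and the codeword is sent through `W`. -/
def outputProb (c : MOIDCode X Y V N K n) (W : DMC X Y) (S : Selection N K) (i : Fin N)
    (u : Bool) : ℝ :=
  (∑ v : V, ∑ y : Fin n → Y, if c.dec i y = u then W.blockProb (c.enc S v) y else 0) /
    (Fintype.card V : ℝ)

/-- Type I decoding error probability: worst case of a selected receiver deciding `F`. -/
def typeIError (c : MOIDCode X Y V N K n) (W : DMC X Y) : ℝ :=
  ⨆ S : Selection N K, ⨆ i : {i : Fin N // i ∈ S.1}, c.outputProb W S i.1 false

/-- Type II decoding error probability: worst case of an unselected receiver deciding `T`. -/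
def typeIIError (c : MOIDCode X Y V N K n) (W : DMC X Y) : ℝ :=
  ⨆ S : Selection N K, ⨆ i : {i : Fin N // i ∉ S.1}, c.outputProb W S i.1 true

/-- The coding rate `(1/n) log log N`, with logarithms to base 2. -/
def rate (_c : MOIDCode X Y V N K n) : ℝ :=
  Real.logb 2 (Real.logb 2 N) / n

end MOIDCode

/-- The class `{h v : v ∈ V}` of hash functions `A → B` is `ε`-almost strongly universal.
The class is indexed by `V` and counted with multiplicity. -/
def IsASU {V A B : Type*} (ε : ℝ) (h : V → A → B) : Prop :=
  (∀ (a : A) (b : B),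
    ({v : V | h v a = b}.ncard : ℝ) = (Nat.card V : ℝ) / (Nat.card B : ℝ)) ∧
  ∀ (a₁ a₂ : A), a₁ ≠ a₂ → ∀ b₁ b₂ : B,
    ({v : V | h v a₁ = b₁ ∧ h v a₂ = b₂}.ncard : ℝ) ≤
      ε * ((Nat.card V : ℝ) / (Nat.card B : ℝ))

/-- An `ε`-almost strongly universal class with the Kurosawa-Yoshida parameters:
for `q = 2 ^ m`, it consists of `q ^ (k + 2)` functions from a set of `N = q ^ (k * q ^ t)`
elements to `GF(q)`, and `ε = k / q + (q ^ t - 1) / q ^ k`. -/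
def IsKYClass (m k t : ℕ)
    (h : Fin ((2 ^ m) ^ (k + 2)) → Fin ((2 ^ m) ^ (k * (2 ^ m) ^ t)) → GaloisField 2 m) : Prop :=
  IsASU ((k : ℝ) / 2 ^ m + (((2 : ℝ) ^ m) ^ t - 1) / ((2 : ℝ) ^ m) ^ k) h

open Classical in
/-- The `K`-MOID code built from a class of hash functions `h` and a transmission code `(f, g)`.
For `S = {i₁ < ⋯ < i_K}`, the encoder sends `f (v, h_v(i₁), …, h_v(i_K))`. Receiver `i` computes
`g(yⁿ) = (v', b₁, …, b_K)` and outputs `T` if and only if `h_{v'}(i) = b_j` for some `j`. -/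
def codingScheme1 {X Y V B : Type*} {N K n : ℕ} (h : V → Fin N → B)
    (f : V × (Fin K → B) → (Fin n → X)) (g : (Fin n → Y) → V × (Fin K → B)) :
    MOIDCode X Y V N K n where
  enc S v := f (v, fun j => h v (S.1.orderEmbOfFin S.2 j))
  dec i y := decide (∃ j : Fin K, h (g y).1 i = (g y).2 j)

end

/-! If the transmission code decodes correctly, every receiver learns `v` and the hashes of the
selected receivers. A selected receiver then accepts. An unselected one accepts only if its hash
collides with one of `K` others, and each collision has probability at most `ε` over `v`. So the
errors are at most `lam` and `lam + K * ε` (`typeIError_codingScheme1_le`,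
`typeIIError_codingScheme1_le`), with `ε ≤ (k + 1) / q`.

The message set has `2 ^ (m * (k + 2 + K))` elements, whereas `log log N = log m + log k + m * (k -
1)`. Both exponents are `m * k + o(n)` when `m` and `k` grow like `√n`, so the identification rate
follows the transmission rate, and `ε` still vanishes. Codes with rate tending to `C` and maximal
error tending to `0` come from `feinstein`, a Chernoff bound and a diagonal choice. The hash classes
concatenate a Reed-Solomon code with a polynomial hash (`exists_isKYClass`). -/

/-! ### Feinstein's maximal code construction -/

open Classical in
/-- Feinstein's lemma: if the information density exceeds `log γ` up to probability `δ`,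
then there are `M` codewords with disjoint decoding sets and maximal error at most `δ + M / γ`. -/
theorem feinstein {X Y : Type*} [Fintype X] [Fintype Y] (W : X → Y → ℝ)
    (hW : ∀ x y, 0 ≤ W x y) (P : X → ℝ) (hP : ∀ x, 0 ≤ P x)
    (hP1 : ∑ x, P x = 1) (hW1 : ∀ x, ∑ y, W x y = 1) (γ δ lam : ℝ) (hγ : 0 < γ)
    (hδ : ∑ x, ∑ y, (if W x y ≤ γ * ∑ x', P x' * W x' y then P x * W x y else 0) ≤ δ)
    (M : ℕ) (hlam : δ + M / γ < lam) :
    ∃ (f : Fin M → X) (D : Fin M → Finset Y), (∀ i j, i ≠ j → Disjoint (D i) (D j)) ∧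
      ∀ i, 1 - lam ≤ ∑ y ∈ D i, W (f i) y := by
  set Q : Y → ℝ := fun y => ∑ x', P x' * W x' y with hQ
  have hQ0 : ∀ y, 0 ≤ Q y := fun y => Finset.sum_nonneg fun x _ => mul_nonneg (hP x) (hW x y)
  -- Codewords are added greedily. The extra condition `γ * Q y < W (f i) y` keeps the `Q`-mass of
  -- each decoding set at most `1 / γ`.
  suffices H : ∀ j ≤ M, ∃ (f : Fin j → X) (D : Fin j → Finset Y),
      (∀ i i', i ≠ i' → Disjoint (D i) (D i')) ∧ (∀ i, 1 - lam ≤ ∑ y ∈ D i, W (f i) y) ∧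
      ∀ i, ∀ y ∈ D i, γ * Q y < W (f i) y by
    obtain ⟨f, D, h1, h2, -⟩ := H M le_rfl
    exact ⟨f, D, h1, h2⟩
  intro j
  induction j with
  | zero => exact fun _ => ⟨Fin.elim0, Fin.elim0, fun i => i.elim0, fun i => i.elim0,
      fun i => i.elim0⟩
  | succ j ih =>
    intro hj
    obtain ⟨f, D, hD, hf, hB⟩ := ih (by omega)
    set U : Finset Y := Finset.univ.biUnion D with hU
    have hQU : ∑ y ∈ U, Q y ≤ j / γ := by
      calc ∑ y ∈ U, Q y = ∑ i, ∑ y ∈ D i, Q y :=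
            Finset.sum_biUnion fun i _ i' _ h => hD i i' h
        _ ≤ ∑ _i : Fin j, 1 / γ := by
            refine Finset.sum_le_sum fun i _ => ?_
            rw [le_div_iff₀ hγ, mul_comm, Finset.mul_sum]
            calc ∑ y ∈ D i, γ * Q y ≤ ∑ y ∈ D i, W (f i) y :=
                  Finset.sum_le_sum fun y hy => (hB i y hy).le
              _ ≤ ∑ y, W (f i) y :=
                  Finset.sum_le_univ_sum_of_nonneg (hW (f i))
              _ = 1 := hW1 _
        _ = j / γ := by simp [div_eq_mul_inv]
    obtain ⟨x, hx⟩ : ∃ x, 1 - lam ≤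
        ∑ y ∈ Finset.univ.filter (fun y => γ * Q y < W x y) \ U, W x y := by
      -- If no codeword can be added, averaging over `P` splits the total mass into low information
      -- (at most `δ`), new decoding set (at most `1 - lam`) and used outputs (at most `j / γ`),
      -- which sum to less than `1`.
      by_contra! hcon
      have h1 : ∀ x, 1 ≤ (∑ y, if W x y ≤ γ * Q y then W x y else 0) + (1 - lam) +
          ∑ y ∈ U, W x y := by
        intro x
        have := (hcon x).le
        refine le_trans ?_ (add_le_add_left (add_le_add_right this _) _)
        rw [← hW1 x, ← Finset.sum_filter]
        have hs : (Finset.univ : Finset Y) ⊆ (Finset.univ.filter (fun y => W x y ≤ γ * Q y) ∪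
            (Finset.univ.filter (fun y => γ * Q y < W x y) \ U)) ∪ U := by
          intro y _
          by_cases hy : y ∈ U
          · simp [hy]
          · rcases le_or_gt (W x y) (γ * Q y) with h | h <;> simp [hy, h]
        have hun : ∀ s t : Finset Y, ∑ y ∈ s ∪ t, W x y ≤ ∑ y ∈ s, W x y + ∑ y ∈ t, W x y := by
          intro s t
          rw [← Finset.sum_union_inter]
          exact le_add_of_nonneg_right (Finset.sum_nonneg fun y _ => hW x y)
        refine (Finset.sum_le_sum_of_subset_of_nonneg hs fun y _ _ => hW x y).trans ?_
        exact (hun _ _).trans (add_le_add_left (hun _ _) _)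
      have h2 : (1 : ℝ) ≤ δ + (1 - lam) + j / γ := by
        calc (1 : ℝ) = ∑ x, P x * 1 := by simp [hP1]
          _ ≤ ∑ x, P x * ((∑ y, if W x y ≤ γ * Q y then W x y else 0) + (1 - lam) +
              ∑ y ∈ U, W x y) :=
            Finset.sum_le_sum fun x _ => mul_le_mul_of_nonneg_left (h1 x) (hP x)
          _ = (∑ x, ∑ y, (if W x y ≤ γ * Q y then P x * W x y else 0)) + (1 - lam) +
              ∑ y ∈ U, Q y := by
            simp only [mul_add, Finset.sum_add_distrib, ← Finset.sum_mul, hP1, one_mul]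
            congr 1
            · congr 1
              simp only [Finset.mul_sum, mul_ite, mul_zero]
            · simp only [Finset.mul_sum]
              rw [Finset.sum_comm]
          _ ≤ _ := by gcongr
      have h3 : (j : ℝ) / γ ≤ M / γ := by
        gcongr
        omega
      linarith
    refine ⟨Fin.cons x f,
      Fin.cons (Finset.univ.filter (fun y => γ * Q y < W x y) \ U) D, ?_, ?_, ?_⟩
    · have hd : ∀ i, Disjoint (Finset.univ.filter (fun y => γ * Q y < W x y) \ U) (D i) :=
        fun i => Finset.disjoint_of_subset_right
          (Finset.subset_biUnion_of_mem D (Finset.mem_univ i)) Finset.sdiff_disjoint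
      intro i i'
      refine Fin.cases ?_ (fun i => ?_) i <;> refine Fin.cases ?_ (fun i' => ?_) i'
      · simp
      · intro _
        simpa using hd i'
      · intro _
        simpa using (hd i).symm
      · intro h
        simpa using hD i i' (fun e => h (by rw [e]))
    · refine Fin.cases ?_ fun i => ?_
      · simpa using hx
      · simpa using hf i
    · refine Fin.cases ?_ fun i => ?_
      · intro y hy
        simp only [Fin.cons_zero, Finset.mem_sdiff, Finset.mem_filter] at hy ⊢
        exact hy.1.2
      · simpa using hB i

/-! ### Chernoff bound and achievability of the capacity -/

theorem sum_pi_prod {ι X : Type*} [Fintype ι] [DecidableEq ι] [Fintype X] (F : ι → X → ℝ) :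
    ∑ x : ι → X, ∏ t, F t (x t) = ∏ t, ∑ x, F t x := by
  rw [Finset.prod_univ_sum, Fintype.piFinset_univ]

namespace DMC

variable {X Y : Type*} [Fintype X] [Fintype Y]

theorem blockProb_nonneg {X : Type*} (W : DMC X Y) {n : ℕ} (x : Fin n → X) (y : Fin n → Y) :
    0 ≤ W.blockProb x y := Finset.prod_nonneg fun _ _ => W.prob_nonneg _ _

theorem sum_blockProb {X : Type*} (W : DMC X Y) {n : ℕ} (x : Fin n → X) :
    ∑ y, W.blockProb x y = 1 := by
  simp only [blockProb]
  rw [sum_pi_prod (fun t y => W.prob (x t) y)]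
  simp [W.sum_prob]

theorem sum_prod_mul_blockProb (W : DMC X Y) (P : X → ℝ) {n : ℕ} (y : Fin n → Y) :
    ∑ x : Fin n → X, (∏ t, P (x t)) * W.blockProb x y = ∏ t, ∑ x, P x * W.prob x (y t) := by
  simp only [blockProb, ← Finset.prod_mul_distrib]
  rw [sum_pi_prod (fun t x => P x * W.prob x (y t))]

/-- The moment generating function of the negative information density. -/
noncomputable def infoMGF (W : DMC X Y) (P : X → ℝ) (s : ℝ) : ℝ :=
  ∑ x, ∑ y, P x * W.prob x y * ((∑ x', P x' * W.prob x' y) / W.prob x y) ^ s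

theorem output_pos (W : DMC X Y) {P : X → ℝ} (hP : ∀ x, 0 ≤ P x) {x : X} {y : Y}
    (h : P x * W.prob x y ≠ 0) : 0 < ∑ x', P x' * W.prob x' y :=
  lt_of_lt_of_le (lt_of_le_of_ne (mul_nonneg (hP x) (W.prob_nonneg x y)) h.symm)
    (Finset.single_le_sum (f := fun x' => P x' * W.prob x' y)
      (fun x' _ => mul_nonneg (hP x') (W.prob_nonneg x' y)) (Finset.mem_univ x))

theorem prob_pos_of_mul_ne_zero {X : Type*} (W : DMC X Y) {P : X → ℝ} {x : X} {y : Y}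
    (h : P x * W.prob x y ≠ 0) : 0 < W.prob x y :=
  lt_of_le_of_ne (W.prob_nonneg x y) (right_ne_zero_of_mul h).symm

theorem infoMGF_zero (W : DMC X Y) {P : X → ℝ} (hP1 : ∑ x, P x = 1) : W.infoMGF P 0 = 1 := by
  simp [infoMGF, ← Finset.mul_sum, W.sum_prob, hP1]

theorem hasDerivAt_infoMGF (W : DMC X Y) {P : X → ℝ} (hP : ∀ x, 0 ≤ P x) :
    HasDerivAt (W.infoMGF P) (-(Real.log 2 * W.mutualInfo P)) 0 := by
  have hsum : -(Real.log 2 * W.mutualInfo P) = ∑ x, ∑ y, P x * W.prob x y *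
      Real.log ((∑ x', P x' * W.prob x' y) / W.prob x y) := by
    have h2 : Real.log 2 ≠ 0 := (Real.log_pos one_lt_two).ne'
    rw [mutualInfo, Finset.mul_sum, ← Finset.sum_neg_distrib]
    refine Finset.sum_congr rfl fun x _ => ?_
    rw [Finset.mul_sum, ← Finset.sum_neg_distrib]
    refine Finset.sum_congr rfl fun y _ => ?_
    rw [← inv_div (W.prob x y), Real.log_inv, Real.logb]
    field_simp
  rw [hsum]
  refine HasDerivAt.fun_sum fun x _ => HasDerivAt.fun_sum fun y _ => ?_
  -- A zero base would make the power discontinuous at `s = 0`; such terms have weight zero.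
  by_cases h : P x * W.prob x y = 0
  · simpa [h] using hasDerivAt_const (0 : ℝ) (0 : ℝ)
  · have hpos := div_pos (W.output_pos hP h) (W.prob_pos_of_mul_ne_zero h)
    have := ((hasDerivAt_id (0 : ℝ)).const_rpow hpos).const_mul (P x * W.prob x y)
    simpa using this

/-- Below the mutual information some Chernoff exponent is positive. -/
theorem exists_chernoff_lt_one (W : DMC X Y) {P : X → ℝ} (hP : ∀ x, 0 ≤ P x)
    (hP1 : ∑ x, P x = 1) {r : ℝ} (hr : r < W.mutualInfo P) :
    ∃ s > 0, ((2 : ℝ) ^ r) ^ s * W.infoMGF P s < 1 := by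
  -- The function equals `1` at `s = 0` and has negative derivative there, so it drops below `1` for
  -- small `s > 0`.
  have hd : HasDerivAt (fun s => ((2 : ℝ) ^ r) ^ s * W.infoMGF P s)
      (Real.log 2 * (r - W.mutualInfo P)) 0 := by
    have h2 : (0 : ℝ) < (2 : ℝ) ^ r := by positivity
    have := ((hasDerivAt_id (0 : ℝ)).const_rpow h2).mul (W.hasDerivAt_infoMGF hP)
    have h3 : Real.log 2 * (r - W.mutualInfo P) =
        Real.log ((2 : ℝ) ^ r) * 1 * ((2 : ℝ) ^ r) ^ (id 0 : ℝ) * W.infoMGF P 0 +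
          ((2 : ℝ) ^ r) ^ (id 0 : ℝ) * -(Real.log 2 * W.mutualInfo P) := by
      rw [W.infoMGF_zero hP1, Real.log_rpow two_pos, id, Real.rpow_zero]
      ring
    rw [h3]
    exact this
  have hneg : Real.log 2 * (r - W.mutualInfo P) < 0 :=
    mul_neg_of_pos_of_neg (Real.log_pos one_lt_two) (by linarith)
  have := (hasDerivWithinAt_iff_tendsto_slope' (by simp)).1
    (hd.hasDerivWithinAt (s := Set.Ioi 0))
  obtain ⟨s, hs, hs0⟩ := ((this.eventually_lt_const hneg).and self_mem_nhdsWithin).exists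
  have hs0 : 0 < s := hs0
  refine ⟨s, hs0, ?_⟩
  rw [slope_def_field, sub_zero, div_neg_iff] at hs
  simp only [Real.rpow_zero, W.infoMGF_zero hP1, one_mul] at hs
  rcases hs with hs | hs <;> linarith [hs.1, hs.2]

-- Chernoff's argument: on the low-information event `1 ≤ (Gⁿ * Q(y) / W(y | x)) ^ s`, and the
-- expectation of the right side factorizes over the `n` letters.
open Classical in
theorem sum_low_information_le (W : DMC X Y) {P : X → ℝ} (hP : ∀ x, 0 ≤ P x)
    (G : ℝ) (hG : 0 < G) (s : ℝ) (hs : 0 < s) (n : ℕ) :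
    ∑ x : Fin n → X, ∑ y : Fin n → Y,
      (if W.blockProb x y ≤ G ^ n * ∑ x' : Fin n → X, (∏ t, P (x' t)) * W.blockProb x' y then
        (∏ t, P (x t)) * W.blockProb x y else 0) ≤ (G ^ s * W.infoMGF P s) ^ n := by
  have hrhs : (G ^ s * W.infoMGF P s) ^ n = ∑ x : Fin n → X, ∑ y : Fin n → Y,
      ∏ t, G ^ s * (P (x t) * W.prob (x t) (y t) *
        ((∑ x', P x' * W.prob x' (y t)) / W.prob (x t) (y t)) ^ s) := by
    have h1 : ∀ x : Fin n → X, ∑ y : Fin n → Y,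
        ∏ t, G ^ s * (P (x t) * W.prob (x t) (y t) *
          ((∑ x', P x' * W.prob x' (y t)) / W.prob (x t) (y t)) ^ s) =
        ∏ t, ∑ y, G ^ s * (P (x t) * W.prob (x t) y *
          ((∑ x', P x' * W.prob x' y) / W.prob (x t) y) ^ s) := fun x =>
      sum_pi_prod (fun t y => G ^ s * (P (x t) * W.prob (x t) y *
          ((∑ x', P x' * W.prob x' y) / W.prob (x t) y) ^ s))
    simp only [h1]
    rw [sum_pi_prod (fun (_ : Fin n) x => ∑ y, G ^ s * (P x * W.prob x y *
          ((∑ x', P x' * W.prob x' y) / W.prob x y) ^ s))]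
    simp [infoMGF, Finset.mul_sum]
  rw [hrhs]
  refine Finset.sum_le_sum fun x _ => Finset.sum_le_sum fun y _ => ?_
  have hq : ∀ t, 0 ≤ ∑ x', P x' * W.prob x' (y t) := fun t =>
    Finset.sum_nonneg fun x' _ => mul_nonneg (hP x') (W.prob_nonneg _ _)
  have hr : ∀ t, 0 ≤ (∑ x', P x' * W.prob x' (y t)) / W.prob (x t) (y t) := fun t =>
    div_nonneg (hq t) (W.prob_nonneg _ _)
  have hc : ∀ t, 0 ≤ P (x t) * W.prob (x t) (y t) := fun t =>
    mul_nonneg (hP _) (W.prob_nonneg _ _)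
  have hpos : 0 ≤ ∏ t, G ^ s * (P (x t) * W.prob (x t) (y t) *
        ((∑ x', P x' * W.prob x' (y t)) / W.prob (x t) (y t)) ^ s) :=
    Finset.prod_nonneg fun t _ => mul_nonneg (by positivity)
      (mul_nonneg (hc t) (Real.rpow_nonneg (hr t) s))
  split_ifs with hle
  swap
  · exact hpos
  rw [W.sum_prod_mul_blockProb P y] at hle
  by_cases h0 : (∏ t, P (x t)) * W.blockProb x y = 0
  · rwa [h0]
  have hWpos : 0 < W.blockProb x y :=
    lt_of_le_of_ne (W.blockProb_nonneg x y) (right_ne_zero_of_mul h0).symm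
  have hone : 1 ≤ ∏ t, G * ((∑ x', P x' * W.prob x' (y t)) / W.prob (x t) (y t)) := by
    rw [Finset.prod_mul_distrib, Finset.prod_div_distrib, Finset.prod_const, Finset.card_univ,
      Fintype.card_fin, ← mul_div_assoc]
    exact (one_le_div hWpos).2 hle
  have hone' := Real.one_le_rpow hone hs.le
  rw [← Real.finsetProd_rpow _ _ fun t _ => mul_nonneg hG.le (hr t)] at hone'
  calc (∏ t, P (x t)) * W.blockProb x y
      ≤ ((∏ t, P (x t)) * W.blockProb x y) *
        ∏ t, (G * ((∑ x', P x' * W.prob x' (y t)) / W.prob (x t) (y t))) ^ s :=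
        le_mul_of_one_le_right
          (mul_nonneg (Finset.prod_nonneg fun t _ => hP _) hWpos.le) hone'
    _ = _ := by
        rw [blockProb, ← Finset.prod_mul_distrib, ← Finset.prod_mul_distrib]
        refine Finset.prod_congr rfl fun t _ => ?_
        rw [Real.mul_rpow hG.le (hr t)]
        ring

/-- Every message of the transmission code `(f, g)` is decoded wrongly with probability at most
`lam`: an event that excludes correct decoding has probability at most `lam`. -/
def MaxErrorLE {X : Type*} (W : DMC X Y) {n : ℕ} {A : Type*} (f : A → Fin n → X)
    (g : (Fin n → Y) → A) (lam : ℝ) : Prop :=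
  ∀ a (s : Set (Fin n → Y)) [DecidablePred (· ∈ s)],
    (∀ y ∈ s, g y ≠ a) → (∑ y, if y ∈ s then W.blockProb (f a) y else 0) ≤ lam

/-- There is a transmission code of length `n` with message set `A` whose maximal error
probability is at most `lam`. -/
def HasCode {X : Type*} (W : DMC X Y) (n : ℕ) (A : Type*) (lam : ℝ) : Prop :=
  ∃ (f : A → Fin n → X) (g : (Fin n → Y) → A), W.MaxErrorLE f g lam

/-- Outputs outside all decoding sets are decoded to an arbitrary message. -/
theorem HasCode.of_disjoint {X : Type*} (W : DMC X Y) {n : ℕ} {A : Type*} [Fintype A] [Nonempty A]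
    {lam : ℝ} (f : Fin (Fintype.card A) → Fin n → X)
    (D : Fin (Fintype.card A) → Finset (Fin n → Y))
    (hD : ∀ i j, i ≠ j → Disjoint (D i) (D j))
    (hf : ∀ i, 1 - lam ≤ ∑ y ∈ D i, W.blockProb (f i) y) : W.HasCode n A lam := by
  classical
  let e := Fintype.equivFin A
  refine ⟨fun a => f (e a), fun y => if h : ∃ i, y ∈ D i then e.symm h.choose else
    Classical.arbitrary A, fun a s _ hs => ?_⟩
  have hsD : ∀ y ∈ s, y ∉ D (e a) := by
    intro y hy hyD
    apply hs y hy
    have h : ∃ i, y ∈ D i := ⟨_, hyD⟩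
    have hi : h.choose = e a := by
      by_contra hne
      exact Finset.disjoint_left.1 (hD _ _ hne) h.choose_spec hyD
    simp only [dif_pos h, hi, Equiv.symm_apply_apply]
  have h1 := W.sum_blockProb (f (e a))
  have h2 := hf (e a)
  rw [← Finset.sum_filter]
  have hdis : Disjoint (Finset.univ.filter (· ∈ s)) (D (e a)) :=
    Finset.disjoint_left.2 fun y hy => hsD y (by simpa using hy)
  have h3 := Finset.sum_le_univ_sum_of_nonneg
    (s := (Finset.univ.filter (· ∈ s)) ∪ D (e a))
    (W.blockProb_nonneg (f (e a)))
  rw [Finset.sum_union hdis] at h3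
  change ∑ y ∈ Finset.univ.filter (· ∈ s), W.blockProb (f (e a)) y ≤ lam
  linarith

/-- Achievability part of the noisy channel coding theorem, with maximal error probability. -/
theorem eventually_hasCode (W : DMC X Y) (hC : 0 < W.capacity) {R lam : ℝ} (hR : R < W.capacity)
    (hlam : 0 < lam) : ∀ᶠ n : ℕ in atTop, ∀ (A : Type) [Fintype A] [Nonempty A],
      (Fintype.card A : ℝ) ≤ 2 ^ (n * R) → W.HasCode n A lam := by
  obtain ⟨P, hP, hRP⟩ : ∃ P ∈ stdSimplex ℝ X, R < W.mutualInfo P := by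
    have hne : (W.mutualInfo '' stdSimplex ℝ X).Nonempty := by
      by_contra h
      rw [Set.not_nonempty_iff_eq_empty] at h
      simp [capacity, h] at hC
    obtain ⟨_, ⟨P, hP, rfl⟩, h⟩ := exists_lt_of_lt_csSup hne hR
    exact ⟨P, hP, h⟩
  -- With `γ = 2 ^ (n * r)`, the gap `R < r` makes `M / γ` decay exponentially, and the gap `r < I`
  -- makes the low-information probability do so.
  obtain ⟨r, hRr, hr⟩ := exists_between hRP
  obtain ⟨s, hs, hlt⟩ := W.exists_chernoff_lt_one hP.1 hP.2 hr
  have h0 : 0 ≤ ((2 : ℝ) ^ r) ^ s * W.infoMGF P s := by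
    refine mul_nonneg (by positivity) (Finset.sum_nonneg fun x _ => Finset.sum_nonneg fun y _ =>
      mul_nonneg (mul_nonneg (hP.1 x) (W.prob_nonneg x y)) (Real.rpow_nonneg (div_nonneg
        (Finset.sum_nonneg fun x' _ => mul_nonneg (hP.1 x') (W.prob_nonneg x' y))
        (W.prob_nonneg x y)) s))
  have ht1 := tendsto_pow_atTop_nhds_zero_of_lt_one h0 hlt
  have hb : (2 : ℝ) ^ (R - r) < 1 :=
    Real.rpow_lt_one_of_one_lt_of_neg one_lt_two (by linarith)
  have ht2 := tendsto_pow_atTop_nhds_zero_of_lt_one (by positivity) hb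
  have ht := ht1.add ht2
  rw [add_zero] at ht
  filter_upwards [ht.eventually_lt_const hlam] with n hn A _ _ hA
  obtain ⟨f, D, hD, hf⟩ := feinstein (fun (x : Fin n → X) (y : Fin n → Y) => W.blockProb x y)
    W.blockProb_nonneg (fun x => ∏ t, P (x t)) (fun x => Finset.prod_nonneg fun t _ => hP.1 _)
    (by rw [sum_pi_prod (fun _ x => P x)]; simp [hP.2]) W.sum_blockProb (((2 : ℝ) ^ r) ^ n) _ lam
    (by positivity) (W.sum_low_information_le hP.1 _ (by positivity) s hs n) (Fintype.card A) (by
      refine lt_of_le_of_lt (add_le_add_right ?_ _) hn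
      rw [div_le_iff₀ (by positivity), ← mul_pow, ← Real.rpow_add two_pos, sub_add_cancel,
        ← Real.rpow_mul_natCast two_pos.le, mul_comm R]
      exact hA)
  exact HasCode.of_disjoint W f D hD hf

end DMC

/-! ### Existence of the hash classes -/

/-- With `d` distinct roots the Vandermonde matrix would force `c = 0`. -/
theorem card_roots_lt {F : Type*} [Field F] {d : ℕ} {c : Fin d → F} (hc : c ≠ 0)
    (s : Finset F) (hs : ∀ x ∈ s, ∑ i, c i * x ^ (i : ℕ) = 0) : s.card < d := by
  by_contra! h
  obtain ⟨s', hs', hcard⟩ := Finset.exists_subset_card_eq h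
  let e := s'.equivFinOfCardEq hcard
  exact hc (Matrix.eq_zero_of_forall_index_sum_mul_pow_eq_zero (f := fun i => (e.symm i : F))
    (Subtype.val_injective.comp e.symm.injective) fun j => hs _ (hs' (e.symm j).2))

/-- Hashing of a word by the polynomial `b + c₀ a + c₁ a² + ⋯`. -/
def innerHash {F : Type*} [Field F] {k : ℕ} (a b : F) (c : Fin k → F) : F :=
  b + ∑ i, c i * a ^ ((i : ℕ) + 1)

/-- Subtracting the two conditions eliminates `b` and leaves a polynomial equation of degree at most
`k` in `a`; each root `a` then determines `b`. The exponents start at `1`, so the constant term `β₂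
- β₁` cannot cancel the nonzero difference `c₁ - c₂`. -/
theorem card_innerHash_pair {F : Type*} [Field F] [Fintype F] [DecidableEq F] {k : ℕ} {c₁ c₂ : Fin k → F}
    (h : c₁ ≠ c₂) (β₁ β₂ : F) :
    ∑ a : F, ∑ b : F, (if innerHash a b c₁ = β₁ ∧ innerHash a b c₂ = β₂ then 1 else 0) ≤ k := by
  have h1 : ∀ a : F, ∑ b : F, (if innerHash a b c₁ = β₁ ∧ innerHash a b c₂ = β₂ then 1 else 0) ≤
      if β₂ - β₁ + ∑ i, (c₁ i - c₂ i) * a ^ ((i : ℕ) + 1) = 0 then 1 else 0 := by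
    intro a
    rw [← Finset.sum_filter, Finset.sum_const, smul_eq_mul, mul_one]
    split_ifs with h0
    · refine Finset.card_le_one.2 fun b hb b' hb' => ?_
      exact add_right_cancel
        ((Finset.mem_filter.1 hb).2.1.trans (Finset.mem_filter.1 hb').2.1.symm)
    · rw [Nat.le_zero, Finset.card_eq_zero, Finset.filter_eq_empty_iff]
      rintro b - ⟨rfl, rfl⟩
      apply h0
      simp only [innerHash, sub_mul, Finset.sum_sub_distrib]
      ring
  refine (Finset.sum_le_sum fun a _ => h1 a).trans ?_
  rw [← Finset.sum_filter, Finset.sum_const, smul_eq_mul, mul_one]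
  have hne : (Fin.cons (β₂ - β₁) (fun i => c₁ i - c₂ i) : Fin (k + 1) → F) ≠ 0 := by
    intro h0
    apply h
    funext i
    have := congrFun h0 i.succ
    simpa [sub_eq_zero] using this
  refine Nat.le_of_lt_succ (card_roots_lt hne _ fun x hx => ?_)
  rw [Fin.sum_univ_succ]
  simpa using hx

/-- The concatenation of a Reed-Solomon hash (evaluation at `x` over the large field `E`)
with the polynomial inner hash over `B`. -/
def kyHash {E B : Type*} [Field E] [Field B] {k d : ℕ} (ι : E → Fin k → B)
    (v : E × B × B) (p : Fin d → E) : B :=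
  innerHash v.2.1 v.2.2 (ι (∑ i, p i * v.1 ^ (i : ℕ)))

theorem ncard_setOf_eq_sum {E B : Type*} [Fintype E] [Fintype B] (P : E × B × B → Prop)
    [DecidablePred P] :
    {v | P v}.ncard = ∑ x : E, ∑ a : B, ∑ b : B, if P (x, a, b) then 1 else 0 := by
  classical
  rw [Set.ncard_eq_toFinset_card', Set.toFinset_ofPred, Finset.card_filter, Fintype.sum_prod_type]
  simp only [Fintype.sum_prod_type]

theorem ncard_kyHash_eq {E B : Type*} [Field E] [Field B] [Fintype E] [Fintype B] {k d : ℕ}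
    (ι : E → Fin k → B) (p : Fin d → E) (β : B) :
    {v | kyHash ι v p = β}.ncard = Fintype.card E * Fintype.card B := by
  classical
  rw [ncard_setOf_eq_sum]
  simp [kyHash, innerHash, ← eq_sub_iff_add_eq]

/-- The outer polynomials agree at no more than `d - 1` points `x`; there each `a` leaves at most
one `b`. At every other `x` the inner words differ and the inner bound `k` applies. -/
theorem ncard_kyHash_pair_le {E B : Type*} [Field E] [Field B] [Fintype E] [Fintype B] {k d : ℕ}
    {ι : E → Fin k → B} (hι : Function.Injective ι) {p₁ p₂ : Fin d → E} (hp : p₁ ≠ p₂)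
    (β₁ β₂ : B) :
    {v | kyHash ι v p₁ = β₁ ∧ kyHash ι v p₂ = β₂}.ncard ≤
      (d - 1) * Fintype.card B + Fintype.card E * k := by
  classical
  rw [ncard_setOf_eq_sum]
  have h1 : ∀ x : E, (∑ a : B, ∑ b : B,
      if kyHash ι (x, a, b) p₁ = β₁ ∧ kyHash ι (x, a, b) p₂ = β₂ then 1 else 0) ≤
      (if ∑ i, (p₁ - p₂) i * x ^ (i : ℕ) = 0 then Fintype.card B else 0) + k := by
    intro x
    split_ifs with h
    · refine le_add_right ?_
      rw [← Finset.card_univ, Finset.card_eq_sum_ones]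
      refine Finset.sum_le_sum fun a _ => ?_
      rw [← Finset.sum_filter, Finset.sum_const, smul_eq_mul, mul_one]
      refine Finset.card_le_one.2 fun b hb b' hb' => ?_
      exact add_right_cancel
        ((Finset.mem_filter.1 hb).2.1.trans (Finset.mem_filter.1 hb').2.1.symm)
    · rw [zero_add]
      have hne : ∑ i, p₁ i * x ^ (i : ℕ) ≠ ∑ i, p₂ i * x ^ (i : ℕ) := by
        simpa only [Pi.sub_apply, sub_mul, Finset.sum_sub_distrib, sub_eq_zero] using h
      exact card_innerHash_pair (hι.ne hne) β₁ β₂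
  refine (Finset.sum_le_sum fun x _ => h1 x).trans ?_
  rw [Finset.sum_add_distrib, ← Finset.sum_filter, Finset.sum_const, Finset.sum_const,
    Finset.card_univ, smul_eq_mul, smul_eq_mul]
  gcongr
  exact Nat.le_sub_one_of_lt (card_roots_lt (sub_ne_zero.2 hp) _ fun x hx => by simpa using hx)

theorem IsASU.comp_equiv {V V' A A' B : Type*} {ε : ℝ} {h : V → A → B} (hh : IsASU ε h)
    (eV : V' ≃ V) (eA : A' ≃ A) : IsASU ε fun v a => h (eV v) (eA a) := by
  have key : ∀ P : V → Prop, {v | P (eV v)}.ncard = {v | P v}.ncard := fun P => by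
    rw [← Set.ncard_image_of_injective _ eV.injective]
    congr 1
    ext v
    simp only [Set.mem_image, Set.mem_ofPred_eq]
    exact ⟨fun ⟨w, hw, e⟩ => e ▸ hw, fun hv => ⟨eV.symm v, by simpa using hv, by simp⟩⟩
  rw [IsASU, Nat.card_congr eV]
  refine ⟨fun a b => ?_, fun a₁ a₂ hne b₁ b₂ => ?_⟩
  · rw [key fun v => h v (eA a) = b]
    exact hh.1 _ _
  · rw [key fun v => h v (eA a₁) = b₁ ∧ h v (eA a₂) = b₂]
    exact hh.2 _ _ (eA.injective.ne hne) _ _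

theorem exists_isKYClass {m k : ℕ} (hm : 1 ≤ m) (hk : 1 ≤ k) (t : ℕ) : ∃ h, IsKYClass m k t h := by
  classical
  let _ : Fintype (GaloisField 2 m) := Fintype.ofFinite _
  let _ : Fintype (GaloisField 2 (m * k)) := Fintype.ofFinite _
  set q := 2 ^ m with hq
  have hB : Fintype.card (GaloisField 2 m) = q := by
    rw [← Nat.card_eq_fintype_card, GaloisField.card 2 m (by omega)]
  have hE : Fintype.card (GaloisField 2 (m * k)) = q ^ k := by
    rw [← Nat.card_eq_fintype_card, GaloisField.card 2 (m * k) (by positivity), pow_mul]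
  -- Only injectivity matters, so any bijection serves; linearity is not needed.
  let ι : GaloisField 2 (m * k) ≃ (Fin k → GaloisField 2 m) :=
    Fintype.equivOfCardEq (by simp [hB, hE])
  let eV : Fin (q ^ (k + 2)) ≃ GaloisField 2 (m * k) × GaloisField 2 m × GaloisField 2 m :=
    Fintype.equivOfCardEq (by simp [hB, hE]; ring)
  let eA : Fin (q ^ (k * q ^ t)) ≃ (Fin (q ^ t) → GaloisField 2 (m * k)) :=
    Fintype.equivOfCardEq (by simp [hE, pow_mul])
  have hqpos : (0 : ℝ) < 2 ^ m := by positivity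
  refine ⟨_, IsASU.comp_equiv (h := kyHash ι) ⟨fun a b => ?_, fun a₁ a₂ hne b₁ b₂ => ?_⟩ eV eA⟩
  · rw [ncard_kyHash_eq, Nat.card_prod, Nat.card_prod, Nat.card_eq_fintype_card,
      Nat.card_eq_fintype_card, hB]
    have : (q : ℝ) ≠ 0 := by positivity
    push_cast
    field_simp
  · refine (Nat.cast_le.2 (ncard_kyHash_pair_le ι.injective hne b₁ b₂)).trans (le_of_eq ?_)
    rw [Nat.card_prod, Nat.card_prod, Nat.card_eq_fintype_card, Nat.card_eq_fintype_card, hB, hE]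
    have h1 : 1 ≤ q ^ t := Nat.one_le_pow _ _ (by positivity)
    have hqc : (q : ℝ) = 2 ^ m := by simp [hq]
    push_cast [Nat.cast_sub h1]
    rw [hqc]
    field_simp
    ring

/-! ### Error probabilities of the coding scheme -/

section Errors

variable {X Y V B : Type*} [Fintype Y] [Fintype V] {N K n : ℕ}

theorem MOIDCode.outputProb_nonneg (c : MOIDCode X Y V N K n) (W : DMC X Y) (S : Selection N K)
    (i : Fin N) (u : Bool) : 0 ≤ c.outputProb W S i u :=
  div_nonneg (Finset.sum_nonneg fun _ _ => Finset.sum_nonneg fun _ _ => by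
    split_ifs
    exacts [W.blockProb_nonneg _ _, le_rfl]) (Nat.cast_nonneg _)

theorem MOIDCode.typeIError_nonneg (c : MOIDCode X Y V N K n) (W : DMC X Y) :
    0 ≤ c.typeIError W :=
  Real.iSup_nonneg fun _ => Real.iSup_nonneg fun _ => c.outputProb_nonneg W _ _ _

theorem MOIDCode.typeIIError_nonneg (c : MOIDCode X Y V N K n) (W : DMC X Y) :
    0 ≤ c.typeIIError W :=
  Real.iSup_nonneg fun _ => Real.iSup_nonneg fun _ => c.outputProb_nonneg W _ _ _

theorem typeIError_codingScheme1_le (W : DMC X Y) {lam : ℝ} (hlam : 0 ≤ lam)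
    (h : V → Fin N → B) {f : V × (Fin K → B) → Fin n → X} {g : (Fin n → Y) → V × (Fin K → B)}
    (hfg : W.MaxErrorLE f g lam) : (codingScheme1 h f g).typeIError W ≤ lam := by
  refine Real.iSup_le (fun S => Real.iSup_le (fun i => ?_) hlam) hlam
  refine div_le_of_le_mul₀ (Nat.cast_nonneg _) hlam ?_
  rw [mul_comm, ← nsmul_eq_mul, ← Finset.card_univ, ← Finset.sum_const]
  refine Finset.sum_le_sum fun v _ => ?_
  refine hfg _ {y | (codingScheme1 h f g).dec i.1 y = false} fun y hy heq => ?_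
  obtain ⟨j, hj⟩ : ∃ j, S.1.orderEmbOfFin S.2 j = i.1 := by
    have := i.2
    rw [← Finset.mem_coe, ← Finset.range_orderEmbOfFin S.1 S.2] at this
    exact this
  simp only [codingScheme1, Set.mem_ofPred_eq, decide_eq_false_iff_not, not_exists] at hy
  exact hy j (by rw [heq]; exact congrArg (h v) hj.symm)

theorem typeIIError_codingScheme1_le [Finite B] (W : DMC X Y) {lam ε : ℝ}
    (hlam : 0 ≤ lam) (hε : 0 ≤ ε) {h : V → Fin N → B} (hh : IsASU ε h)
    {f : V × (Fin K → B) → Fin n → X} {g : (Fin n → Y) → V × (Fin K → B)}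
    (hfg : W.MaxErrorLE f g lam) : (codingScheme1 h f g).typeIIError W ≤ lam + K * ε := by
  classical
  have hnn : 0 ≤ lam + K * ε := by positivity
  let _ := Fintype.ofFinite B
  refine Real.iSup_le (fun S => Real.iSup_le (fun i => ?_) hnn) hnn
  refine div_le_of_le_mul₀ (Nat.cast_nonneg _) hnn ?_
  set e := S.1.orderEmbOfFin S.2
  have hcol : ∀ j, ((Finset.univ.filter fun v => h v i.1 = h v (e j)).card : ℝ) ≤
      ε * Fintype.card V := by
    intro j
    have hne : i.1 ≠ e j := fun h0 => i.2 (h0 ▸ Finset.orderEmbOfFin_mem S.1 S.2 j)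
    -- Splitting a collision by the common hash value `b` and summing over `B` cancels the factor `1
    -- / |B|`.
    have hsub : (Finset.univ.filter fun v => h v i.1 = h v (e j)) =
        Finset.univ.biUnion fun b => Finset.univ.filter fun v => h v i.1 = b ∧ h v (e j) = b := by
      ext v
      simp [eq_comm]
    rw [hsub]
    refine (Nat.cast_le.2 Finset.card_biUnion_le).trans ?_
    rw [Nat.cast_sum]
    calc ∑ b : B, ((Finset.univ.filter fun v => h v i.1 = b ∧ h v (e j) = b).card : ℝ)
        ≤ ∑ _b : B, ε * ((Nat.card V : ℝ) / (Nat.card B : ℝ)) := by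
          refine Finset.sum_le_sum fun b _ => ?_
          have := hh.2 i.1 (e j) hne b b
          rwa [Set.ncard_eq_toFinset_card', Set.toFinset_ofPred] at this
      _ ≤ ε * Fintype.card V := by
          rw [Finset.sum_const, Finset.card_univ, nsmul_eq_mul, Nat.card_eq_fintype_card,
            Nat.card_eq_fintype_card, mul_left_comm]
          refine mul_le_mul_of_nonneg_left ?_ hε
          rcases eq_or_ne (Fintype.card B : ℝ) 0 with h0 | h0
          · simp [h0]
          · rw [mul_div_cancel₀ _ h0]
  -- For `v` with a collision the probability is bounded by `1`; for the others, acceptance implies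
  -- a transmission error.
  have hv : ∀ v, (∑ y : Fin n → Y, if (codingScheme1 h f g).dec i.1 y = true then
      W.blockProb ((codingScheme1 h f g).enc S v) y else 0) ≤
      lam + ∑ j, if h v i.1 = h v (e j) then 1 else 0 := by
    intro v
    have hs : 0 ≤ ∑ j, if h v i.1 = h v (e j) then (1 : ℝ) else 0 :=
      Finset.sum_nonneg fun j _ => by positivity
    by_cases hc : ∃ j, h v i.1 = h v (e j)
    · obtain ⟨j, hj⟩ := hc
      have h1 : (1 : ℝ) ≤ ∑ j, if h v i.1 = h v (e j) then (1 : ℝ) else 0 := by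
        refine le_trans ?_ (Finset.single_le_sum (fun j _ => by positivity) (Finset.mem_univ j))
        simp [hj]
      have h2 : (∑ y : Fin n → Y, if (codingScheme1 h f g).dec i.1 y = true then
          W.blockProb ((codingScheme1 h f g).enc S v) y else 0) ≤ 1 := by
        rw [← W.sum_blockProb ((codingScheme1 h f g).enc S v)]
        refine Finset.sum_le_sum fun y _ => ?_
        split_ifs
        exacts [le_rfl, W.blockProb_nonneg _ _]
      linarith
    · refine le_add_of_le_of_nonneg (hfg _ {y | (codingScheme1 h f g).dec i.1 y = true}
        fun y hy heq => hc ?_) hs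
      simp only [codingScheme1, Set.mem_ofPred_eq, decide_eq_true_eq] at hy
      rw [heq] at hy
      exact hy
  refine (Finset.sum_le_sum fun v _ => hv v).trans ?_
  rw [Finset.sum_add_distrib, Finset.sum_comm, Finset.sum_const, Finset.card_univ, nsmul_eq_mul,
    add_mul, mul_comm lam, mul_assoc]
  gcongr
  calc ∑ j : Fin K, ∑ v, (if h v i.1 = h v (e j) then (1 : ℝ) else 0)
      ≤ ∑ _j : Fin K, ε * Fintype.card V := by
        refine Finset.sum_le_sum fun j _ => ?_
        rw [Finset.sum_boole]
        exact hcol j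
    _ = _ := by simp

end Errors

/-! ### Choice of parameters and limits -/

/-- `J n` is the largest `j ≤ n` with `p j n`. `Nat.findGreatest` defaults to `0`, so `p 0 n`
guarantees that the value found satisfies `p`. -/
theorem exists_diagonal {p : ℕ → ℕ → Prop} (h : ∀ j, ∀ᶠ n in atTop, p j n) :
    ∃ J : ℕ → ℕ, Tendsto J atTop atTop ∧ ∀ᶠ n in atTop, p (J n) n := by
  classical
  refine ⟨fun n => Nat.findGreatest (fun j => p j n) n, tendsto_atTop.2 fun j => ?_, ?_⟩
  · filter_upwards [h j, eventually_ge_atTop j] with n hn hj using Nat.le_findGreatest hj hn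
  · filter_upwards [h 0] with n hn
    exact Nat.findGreatest_spec (P := fun j => p j n) (Nat.zero_le n) hn

theorem logb_two_natCast_le {a : ℕ} (ha : 1 ≤ a) : Real.logb 2 a ≤ a := by
  rw [Real.logb_le_iff_le_rpow one_lt_two (by exact_mod_cast ha), Real.rpow_natCast]
  exact_mod_cast Nat.lt_two_pow_self.le

theorem logb_logb_kyClass_size {m k : ℕ} (hm : 1 ≤ m) (hk : 1 ≤ k) (t : ℕ) :
    Real.logb 2 (Real.logb 2 (((2 ^ m) ^ (k * (2 ^ m) ^ t) : ℕ) : ℝ)) =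
      Real.logb 2 m + Real.logb 2 k + m * t := by
  have hm0 : (m : ℝ) ≠ 0 := by positivity
  have hk0 : (k : ℝ) ≠ 0 := by positivity
  have h1 : Real.logb 2 (((2 ^ m) ^ (k * (2 ^ m) ^ t) : ℕ) : ℝ) = m * k * 2 ^ (m * t) := by
    push_cast
    rw [← pow_mul, Real.logb_pow, Real.logb_self_eq_one one_lt_two]
    push_cast
    rw [pow_mul]
    ring
  rw [h1, Real.logb_mul (by positivity) (by positivity), Real.logb_mul hm0 hk0, Real.logb_pow,
    Real.logb_self_eq_one one_lt_two]
  push_cast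
  ring

/-- With `t = k - 1` the second summand is below `q ^ (k - 1) / q ^ k = 1 / q`. -/
theorem kyClass_epsilon_le {m k : ℕ} (hk : 1 ≤ k) :
    (k : ℝ) / 2 ^ m + (((2 : ℝ) ^ m) ^ (k - 1) - 1) / ((2 : ℝ) ^ m) ^ k ≤ (k + 1) / 2 ^ m := by
  rw [add_div]
  refine add_le_add_right ?_ _
  rw [div_le_div_iff₀ (by positivity) (by positivity), sub_mul, ← pow_succ,
    Nat.sub_add_cancel hk, one_mul, one_mul]
  exact sub_le_self _ (by positivity)

theorem kyClass_epsilon_nonneg (m k t : ℕ) :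
    0 ≤ (k : ℝ) / 2 ^ m + (((2 : ℝ) ^ m) ^ t - 1) / ((2 : ℝ) ^ m) ^ k := by
  have : (1 : ℝ) ≤ ((2 : ℝ) ^ m) ^ t := one_le_pow₀ (one_le_pow₀ one_le_two)
  exact add_nonneg (by positivity) (div_nonneg (by linarith) (by positivity))

theorem tendsto_sqrt_add_one_atTop : Tendsto (fun n : ℕ => n.sqrt + 1) atTop atTop := by
  refine tendsto_atTop.2 fun b => ?_
  filter_upwards [eventually_ge_atTop (b * b)] with n hn
  exact (Nat.le_sqrt.2 hn).trans (Nat.le_succ _)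

theorem tendsto_sqrt_add_one_div :
    Tendsto (fun n : ℕ => ((n.sqrt + 1 : ℕ) : ℝ) / n) atTop (𝓝 0) := by
  -- For `n ≥ 1`, `√n + 1 ≤ 2 * √n` gives `(√n + 1)² ≤ 4 * n`, with `√n` the integer root.
  have h1 : Tendsto (fun n : ℕ => 4 / ((n.sqrt + 1 : ℕ) : ℝ)) atTop (𝓝 0) :=
    tendsto_const_nhds.div_atTop (tendsto_natCast_atTop_atTop.comp tendsto_sqrt_add_one_atTop)
  refine squeeze_zero' (Eventually.of_forall fun n => by positivity) ?_ h1
  filter_upwards [eventually_ge_atTop 1] with n hn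
  have hs : 1 ≤ n.sqrt := Nat.le_sqrt.2 (by simpa using hn)
  have hle : n.sqrt * n.sqrt ≤ n := Nat.sqrt_le n
  rw [div_le_div_iff₀ (by positivity) (by positivity)]
  norm_cast
  nlinarith

theorem tendsto_linear_div_two_pow_sqrt (C : ℝ) :
    Tendsto (fun n : ℕ => (C * ((n.sqrt + 1 : ℕ) : ℝ) + 1) / 2 ^ (n.sqrt + 1)) atTop (𝓝 0) := by
  have h1 := (tendsto_pow_const_div_const_pow_of_one_lt 1 (one_lt_two (α := ℝ))).const_mul C
  have h0 := tendsto_pow_const_div_const_pow_of_one_lt 0 (one_lt_two (α := ℝ))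
  have := (h1.add h0).comp tendsto_sqrt_add_one_atTop
  rw [mul_zero, add_zero] at this
  refine this.congr fun n => ?_
  simp only [Function.comp_apply, pow_one, pow_zero]
  ring

/-- The growth of the hash parameters `m = √n + 1` and `k = ⌊n r / m⌋ - (2 + K)`, for
transmission rates `r` tending to `C`. -/
theorem kyParameters_asymptotics {C : ℝ} (hC : 0 < C) {r : ℕ → ℝ} (hr : Tendsto r atTop (𝓝 C))
    (hrC : ∀ n, r n ≤ C) (K : ℕ) {m k : ℕ → ℕ} (hm : ∀ n, m n = n.sqrt + 1)
    (hk : ∀ n, k n = max 1 (⌊n * r n / m n⌋₊ - (2 + K))) :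
    Tendsto (fun n => Real.logb 2 (Real.logb 2
      (((2 ^ m n) ^ (k n * (2 ^ m n) ^ (k n - 1)) : ℕ) : ℝ)) / (n : ℝ)) atTop (𝓝 C) ∧
    Tendsto (fun n => ((k n : ℝ) + 1) / 2 ^ m n) atTop (𝓝 0) ∧
    ∀ᶠ n : ℕ in atTop, (m n * (k n + 2 + K) : ℝ) ≤ n * r n := by
  have hmdiv : Tendsto (fun n => (m n : ℝ) / n) atTop (𝓝 0) := by
    simpa only [hm] using tendsto_sqrt_add_one_div
  have hm1 : ∀ n, 1 ≤ m n := fun n => by rw [hm]; omega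
  have hmpos : ∀ n, (0 : ℝ) < m n := fun n => by exact_mod_cast hm1 n
  have hk1 : ∀ n, 1 ≤ k n := fun n => by rw [hk]; exact le_max_left _ _
  have hmtop : Tendsto (fun n => (m n : ℝ)) atTop atTop := by
    simp only [hm]
    exact tendsto_natCast_atTop_atTop.comp tendsto_sqrt_add_one_atTop
  have hndiv : Tendsto (fun n : ℕ => (n : ℝ) / m n) atTop atTop := by
    have h0 : Tendsto (fun n => (m n : ℝ) / n) atTop (𝓝[>] 0) := by
      refine tendsto_nhdsWithin_iff.2 ⟨hmdiv, ?_⟩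
      filter_upwards [eventually_gt_atTop 0] with n hn
      exact div_pos (hmpos n) (by exact_mod_cast hn)
    refine h0.inv_tendsto_nhdsGT_zero.congr fun n => ?_
    simp
  have hL : Tendsto (fun n : ℕ => ⌊n * r n / m n⌋₊) atTop atTop := by
    refine tendsto_nat_floor_atTop.comp ?_
    refine (hndiv.atTop_mul_pos hC hr).congr fun n => ?_
    ring
  have hrpos := hr.eventually_const_lt hC
  have hmain : ∀ᶠ n : ℕ in atTop, (k n : ℝ) + 2 + K ≤ n * r n / m n ∧
      n * r n / m n < k n + 3 + K := by
    -- Once the floor reaches `3 + K`, neither the truncated subtraction nor the `max` has any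
    -- effect.
    filter_upwards [hL.eventually_ge_atTop (3 + K), hrpos] with n hn hrn
    have hkn : k n + (2 + K) = ⌊n * r n / m n⌋₊ := by rw [hk]; omega
    have hkr : (k n : ℝ) + (2 + K) = (⌊n * r n / m n⌋₊ : ℝ) := by exact_mod_cast hkn
    have h1 := Nat.floor_le (a := n * r n / m n) (by have := hmpos n; positivity)
    have h2 := Nat.lt_floor_add_one (n * r n / m n)
    constructor <;> linarith
  refine ⟨?_, ?_, ?_⟩
  -- The lower bound drops both logarithms; `4 + K` collects `2 + K`, the floor and the `1` in `k -
  -- 1`. The upper bound uses `log m ≤ m` and `log k ≤ k ≤ C * n / m`.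
  · have hlow : Tendsto (fun n : ℕ => r n - (m n : ℝ) / n * (4 + K)) atTop (𝓝 C) := by
      simpa using hr.sub (hmdiv.mul_const _)
    have hup : Tendsto (fun n : ℕ => r n + (m n : ℝ) / n + C / m n) atTop (𝓝 C) := by
      simpa using (hr.add hmdiv).add (tendsto_const_nhds.div_atTop hmtop)
    refine tendsto_of_tendsto_of_tendsto_of_le_of_le' hlow hup ?_ ?_
    · filter_upwards [hmain, eventually_gt_atTop 0] with n hn hn0
      have hnpos : (0 : ℝ) < n := by exact_mod_cast hn0
      rw [logb_logb_kyClass_size (hm1 n) (hk1 n), le_div_iff₀ hnpos]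
      have h1 : 0 ≤ Real.logb 2 (m n) :=
        Real.logb_nonneg one_lt_two (by exact_mod_cast hm1 n)
      have h2 : 0 ≤ Real.logb 2 (k n) :=
        Real.logb_nonneg one_lt_two (by exact_mod_cast hk1 n)
      have h3 := (div_lt_iff₀ (hmpos n)).1 hn.2
      have h4 : (r n - (m n : ℝ) / n * (4 + K)) * n = n * r n - m n * (4 + K) := by
        field_simp
      rw [h4, Nat.cast_sub (hk1 n)]
      push_cast
      linarith
    · filter_upwards [hmain, eventually_gt_atTop 0] with n hn hn0
      have hnpos : (0 : ℝ) < n := by exact_mod_cast hn0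
      rw [logb_logb_kyClass_size (hm1 n) (hk1 n), div_le_iff₀ hnpos]
      have h1 := logb_two_natCast_le (hm1 n)
      have h2 := logb_two_natCast_le (hk1 n)
      have h3 := (le_div_iff₀ (hmpos n)).1 hn.1
      have hK : (0 : ℝ) ≤ K := Nat.cast_nonneg K
      have h5 : (n : ℝ) * r n / m n ≤ C / m n * n := by
        rw [div_mul_eq_mul_div, mul_comm C]
        have := hmpos n
        have := hrC n
        gcongr
      have h4 : (r n + (m n : ℝ) / n + C / m n) * n = n * r n + m n + C / m n * n := by
        field_simp
      rw [h4, Nat.cast_sub (hk1 n)]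
      push_cast
      have := mul_nonneg (hmpos n).le hK
      linarith [hmpos n, hn.1]
  · have := tendsto_linear_div_two_pow_sqrt C
    simp only [← hm] at this
    refine squeeze_zero' (Eventually.of_forall fun n => by positivity) ?_ this
    filter_upwards [hmain] with n hn
    gcongr
    -- From `n ≤ m²` follows `k ≤ C * n / m ≤ C * m`, which `2 ^ m` dominates.
    have hnm : (n : ℝ) ≤ m n * m n := by
      rw [hm]
      exact_mod_cast (Nat.lt_succ_sqrt n).le
    have hK : (0 : ℝ) ≤ K := Nat.cast_nonneg K
    have h5 : (n : ℝ) * r n / m n ≤ C * m n := by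
      rw [div_le_iff₀ (hmpos n)]
      calc (n : ℝ) * r n ≤ n * C := by have := hrC n; gcongr
        _ ≤ m n * m n * C := by gcongr
        _ = _ := by ring
    linarith [hn.1]
  · filter_upwards [hmain] with n hn
    have h3 := (le_div_iff₀ (hmpos n)).1 hn.1
    linarith

theorem corollary1 {X Y : Type*} [Fintype X] [Fintype Y] (W : DMC X Y) (hC : 0 < W.capacity)
    (K : ℕ) (hK : 1 ≤ K) :
    -- parameters of the hash classes, for every code length `n`
    ∃ k m : ℕ → ℕ, (∀ n, 1 ≤ k n ∧ 1 ≤ m n) ∧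
      -- such hash classes exist
      (∀ n, ∃ h, IsKYClass (m n) (k n) (k n - 1) h) ∧
      -- transmission codes of length `n` for the channel
      ∃ (f : ∀ n, Fin ((2 ^ m n) ^ (k n + 2)) × (Fin K → GaloisField 2 (m n)) → (Fin n → X))
        (g : ∀ n, (Fin n → Y) → Fin ((2 ^ m n) ^ (k n + 2)) × (Fin K → GaloisField 2 (m n))),
        -- whichever hash classes with these parameters are used
        ∀ h : ∀ n, Fin ((2 ^ m n) ^ (k n + 2)) →
            Fin ((2 ^ m n) ^ (k n * (2 ^ m n) ^ (k n - 1))) → GaloisField 2 (m n),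
          (∀ n, IsKYClass (m n) (k n) (k n - 1) (h n)) →
            Tendsto (fun n => (codingScheme1 (h n) (f n) (g n)).rate) atTop (𝓝 W.capacity) ∧
            Tendsto (fun n => (codingScheme1 (h n) (f n) (g n)).typeIError W) atTop (𝓝 0) ∧
            Tendsto (fun n => (codingScheme1 (h n) (f n) (g n)).typeIIError W) atTop (𝓝 0) := by
  classical
  -- Over an empty alphabet the simplex is empty and the capacity would be `sSup ∅ = 0`.
  have hX : Nonempty X := by
    by_contra hX
    rw [not_nonempty_iff] at hX
    have : stdSimplex ℝ X = ∅ := by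
      ext P
      simp [stdSimplex]
    simp [DMC.capacity, this] at hC
  -- Stage `j` asks for rate `C - 1 / (j + 1)` and error `1 / (j + 1)`; letting `j = J n` grow
  -- removes both margins.
  obtain ⟨J, hJ, hcode⟩ := exists_diagonal (fun j : ℕ =>
    W.eventually_hasCode hC (R := W.capacity - 1 / ((j : ℝ) + 1)) (lam := 1 / ((j : ℝ) + 1))
      (sub_lt_self _ (by positivity)) (by positivity))
  set d : ℕ → ℝ := fun n => 1 / ((J n : ℝ) + 1) with hd
  have hd0 : ∀ n, 0 ≤ d n := fun n => by positivity
  have hdlim : Tendsto d atTop (𝓝 0) := tendsto_one_div_add_atTop_nhds_zero_nat.comp hJ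
  let m : ℕ → ℕ := fun n => n.sqrt + 1
  let k : ℕ → ℕ := fun n => max 1 (⌊n * (W.capacity - d n) / m n⌋₊ - (2 + K))
  have hm1 : ∀ n, 1 ≤ m n := fun n => by simp [m]
  have hk1 : ∀ n, 1 ≤ k n := fun n => le_max_left _ _
  obtain ⟨hrate, heps, hsize⟩ := kyParameters_asymptotics (r := fun n => W.capacity - d n) hC
    (by simpa using hdlim.const_sub W.capacity) (fun n => sub_le_self _ (hd0 n)) K
    (m := m) (k := k) (fun _ => rfl) (fun _ => rfl)
  let A : ℕ → Type := fun n => Fin ((2 ^ m n) ^ (k n + 2)) × (Fin K → GaloisField 2 (m n))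
  have hA : ∀ n, Nonempty (A n) := fun n => ⟨⟨⟨0, by positivity⟩, fun _ => 0⟩⟩
  have hcodes : ∀ᶠ n in atTop, W.HasCode n (A n) (d n) := by
    filter_upwards [hcode, hsize] with n hn hs
    let _ : Fintype (GaloisField 2 (m n)) := Fintype.ofFinite _
    have hB : Fintype.card (GaloisField 2 (m n)) = 2 ^ m n := by
      rw [← Nat.card_eq_fintype_card, GaloisField.card 2 (m n) (by have := hm1 n; omega)]
    refine @hn (A n) inferInstance (hA n) ?_
    have hcard : Fintype.card (A n) = 2 ^ (m n * (k n + 2 + K)) := by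
      simp only [A, Fintype.card_prod, Fintype.card_fin, Fintype.card_fun, hB]
      rw [← pow_add, ← pow_mul]
    rw [hcard]
    push_cast
    rw [← Real.rpow_natCast]
    exact Real.rpow_le_rpow_of_exponent_le one_le_two (by push_cast; exact hs)
  -- For the finitely many lengths without a good code any encoder and decoder will do.
  have hfg : ∀ n, ∃ fg : (A n → Fin n → X) × ((Fin n → Y) → A n),
      W.HasCode n (A n) (d n) → W.MaxErrorLE fg.1 fg.2 (d n) := by
    intro n
    by_cases h : W.HasCode n (A n) (d n)
    · obtain ⟨f, g, hfg⟩ := h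
      exact ⟨(f, g), fun _ => hfg⟩
    · exact ⟨(fun _ _ => Classical.arbitrary X, fun _ => (hA n).some), fun h' => (h h').elim⟩
  choose fg hfg using hfg
  refine ⟨k, m, fun n => ⟨hk1 n, hm1 n⟩, fun n => exists_isKYClass (hm1 n) (hk1 n) _,
    fun n => (fg n).1, fun n => (fg n).2, fun h hh => ⟨hrate, ?_, ?_⟩⟩
  · refine squeeze_zero' (Eventually.of_forall fun n => MOIDCode.typeIError_nonneg _ W) ?_ hdlim
    filter_upwards [hcodes] with n hn
    exact typeIError_codingScheme1_le W (hd0 n) (h n) (hfg n hn)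
  · have hlim : Tendsto (fun n => d n + K * (((k n : ℝ) + 1) / 2 ^ m n)) atTop (𝓝 0) := by
      simpa using hdlim.add (heps.const_mul (K : ℝ))
    refine squeeze_zero' (Eventually.of_forall fun n => MOIDCode.typeIIError_nonneg _ W) ?_ hlim
    filter_upwards [hcodes] with n hn
    refine (typeIIError_codingScheme1_le W (hd0 n) (kyClass_epsilon_nonneg _ _ _) (hh n)
      (hfg n hn)).trans ?_
    gcongr
    exact kyClass_epsilon_le (hk1 n)
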